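/- Conventions. $V$ is a finite set. Graphs on $V$ have directed edges (arrows) and undirected edges, no loops, and at most one edge between two vertices. A graph is an *LWF chain graph* if it has no partially directed cycle, that is, no sequence of $n\ge 3$ distinct vertices $v_1,\dots,v_n$, $v_{n+1}=v_1$, such that for every $i$ either $v_i-v_{i+1}$ or $v_i\to v_{i+1}$, with $v_j\to v_{j+1}$ for at least one $j$. Let $\mathrm{An}(A)$ be the smallest set containing $A$ that contains every parent and every undirected neighbour of each of its elements. The moral graph $G^m$ is the undirected graph in which $\alpha\ne\beta$ are adjacent iff they are joined by an edge of $G$ or there are $\gamma_1,\gamma_2$ in the same chain component (connected component after removing the arrows) with $\alpha\to\gamma_1$, $\beta\to\gamma_2$. The set $S$ *c-separates* $A$ from $B$ in $G$ if $S$ separates $A$ from $B$ in $(G_{\mathrm{An}(A\cup B\cup S)})^m$. A joint probability distribution $p$ of random variables $(X_v)_{v\in V}$ (with values in standard Borel spaces) is *faithful* to $G$ if for all pairwise disjoint $A,B,S\subseteq V$: $A\perp\!\!\!\perp_p B\mid S$ if and only if $S$ c-separates $A$ from $B$ in $G$. A *minimal complex* is an induced subgraph of the form $a\to v_1-\cdots-v_r\gets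 b$, $r\ge 1$, with distinct vertices. The *pattern* of a graph is obtained by replacing each arrow that belongs to no minimal complex by an undirected edge. Algorithm (PC4LWF), with exact access to the conditional independencies of $p$. Skeleton recovery: start with the complete undirected graph $H$ on $V$. For $i=0,\dots,|V|-2$ do, as long as possible: select an ordered pair $(u,v)$ of vertices adjacent in $H$ with $|ad_H(u)\setminus\{v\}|\ge i$ and a set $S\subseteq ad_H(u)\setminus\{v\}$ with $|S|=i$ and $u\perp\!\!\!\perp_p v\mid S$; put $S_{uv}=S_{vu}=S$ and remove the edge $u-v$ from $H$. Complex recovery: put $H^*=H$; for each pair of distinct vertices $u,v$ not adjacent in $H$ (in both roles) and each edge $u-w$ that is currently undirected in $H^*$, if $u\not\perp\!\!\!\perp_p v\mid S_{uv}\cup\{w\}$, orient $u-w$ as $u\to w$ in $H^*$. Final step: replace $H^*$ by its pattern. The pattern is computed by labelling: two arrows $u_1\to w_1$, $u_2\to w_2$ of $H^*$, with $u_1\ne u_2$ not adjacent, are labelled if there is an undirected path in $H^*$ from $w_1$ to $w_2$ (of length zero if $w_1=w_2$) on which $u_1$ is adjacent to no vertex other than $w_1$ and $u_2$ is adjacent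 to no vertex other than $w_2$; then all unlabelled arrows are replaced by undirected edges. Lemma. Let $p$ be faithful to an LWF chain graph $G$ on $V$. Then the algorithm has at least one completed run, and for every completed run, whatever the orders of selection, the graph $H^*$ after the final step has the same adjacencies and the same minimal complexes as $G$; it is equal to the pattern of $G$. Moreover, the labelling procedure indeed produces the pattern of $H^*$. -/

import Mathlib

namespace LWF

/-- A graph with directed and undirected edges, encoded by its set of
ordered pairs `E`: an arrow from `a` to `b` when only `(a, b)` is present, an undirected edge
when both `(a, b)` and `(b, a)` are present. There are no loops, and any two vertices are joined
by at most one edge. -/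
@[ext]
structure MixedGraph (V : Type*) where
  E : V → V → Prop
  irrefl : ∀ a, ¬ E a a

namespace MixedGraph

variable {V : Type*}

/-- There is an arrow from `a` to `b`. -/
def Arrow (G : MixedGraph V) (a b : V) : Prop := G.E a b ∧ ¬ G.E b a

/-- There is an undirected edge between `a` and `b`. -/
def Line (G : MixedGraph V) (a b : V) : Prop := G.E a b ∧ G.E b a

/-- Adjacency in the skeleton: an arrow in either direction or an undirected edge. -/
def Adj (G : MixedGraph V) (a b : V) : Prop := G.Arrow a b ∨ G.Arrow b a ∨ G.Line a b

/-- A partially directed cycle: distinct vertices `c 0, …, c (n - 1)` with `n ≥ 3`, closed up by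
`c n = c 0`, where consecutive vertices are joined by an undirected edge or by an arrow
pointing forwards, at least one of them being an arrow. -/
def HasPartiallyDirectedCycle (G : MixedGraph V) : Prop :=
  ∃ (n : ℕ) (c : ℕ → V), 3 ≤ n ∧ Set.InjOn c (Set.Iio n) ∧ c n = c 0 ∧
    (∀ i < n, G.Line (c i) (c (i + 1)) ∨ G.Arrow (c i) (c (i + 1))) ∧
    ∃ j < n, G.Arrow (c j) (c (j + 1))

/-- LWF chain graphs. -/
def IsChainGraph (G : MixedGraph V) : Prop := ¬ G.HasPartiallyDirectedCycle

/-- The boundary of `A`: the parents and neighbours, outside `A`, of vertices in `A`. -/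
def bd (G : MixedGraph V) (A : Set V) : Set V :=
  {v | v ∉ A ∧ ∃ a ∈ A, G.Arrow v a ∨ G.Line v a}

/-- `A` is ancestral: it contains the boundary of each of its elements. -/
def IsAncestral (G : MixedGraph V) (A : Set V) : Prop := ∀ a ∈ A, G.bd {a} ⊆ A

/-- The smallest ancestral set containing `A`. -/
def An (G : MixedGraph V) (A : Set V) : Set V := ⋂₀ {B | A ⊆ B ∧ G.IsAncestral B}

/-- The subgraph induced by `A`, kept on the vertex type `V`: the vertices outside `A` become
isolated. -/
def induce (G : MixedGraph V) (A : Set V) : MixedGraph V where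
  E a b := a ∈ A ∧ b ∈ A ∧ G.E a b
  irrefl a h := G.irrefl a h.2.2

/-- `a` and `b` lie in the same chain component, i.e. in the same connected component of the graph
left after the removal of all arrows. -/
def SameComponent (G : MixedGraph V) (a b : V) : Prop := Relation.ReflTransGen G.Line a b

/-- The moral graph. -/
def moral (G : MixedGraph V) : SimpleGraph V :=
  SimpleGraph.fromRel fun a b => G.Arrow a b ∨ G.Line a b ∨ G.Arrow b a ∨
    ∃ c d, G.SameComponent c d ∧ G.Arrow a c ∧ G.Arrow b d

/-- `S` c-separates `A` from `B`: in the moral graph of the subgraph induced by the smallest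
ancestral set containing `A ∪ B ∪ S`, every walk from `A` to `B` meets `S`. -/
def CSep (G : MixedGraph V) (A B S : Set V) : Prop :=
  ∀ a ∈ A, ∀ b ∈ B, ∀ w : (G.induce (G.An (A ∪ B ∪ S))).moral.Walk a b, ∃ s ∈ w.support, s ∈ S

/-- The vertices `a, v 0, …, v r, b` are distinct and the subgraph they induce is the minimal
complex `a → v 0 − ⋯ − v r ← b`. -/
structure IsMinimalComplex (G : MixedGraph V) {r : ℕ} (a : V) (v : Fin (r + 1) → V) (b : V) :
    Prop where
  ne : a ≠ b
  left_ne : ∀ i, a ≠ v i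
  right_ne : ∀ i, b ≠ v i
  inj : Function.Injective v
  left : G.Arrow a (v 0)
  right : G.Arrow b (v (Fin.last r))
  lines : ∀ i j : Fin (r + 1), (i : ℕ) + 1 = j → G.Line (v i) (v j)
  not_adj : ¬ G.Adj a b
  left_only : ∀ i, G.Adj a (v i) → i = 0
  right_only : ∀ i, G.Adj b (v i) → i = Fin.last r
  chordless : ∀ i j : Fin (r + 1), G.Adj (v i) (v j) → (i : ℕ) + 1 = j ∨ (j : ℕ) + 1 = i

/-- Two graphs on the same vertices have the same adjacencies. -/
def SameAdjacencies (G K : MixedGraph V) : Prop := ∀ a b, G.Adj a b ↔ K.Adj a b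

/-- Two graphs on the same vertices have the same minimal complexes. -/
def SameMinimalComplexes (G K : MixedGraph V) : Prop :=
  ∀ (r : ℕ) (a : V) (v : Fin (r + 1) → V) (b : V),
    G.IsMinimalComplex a v b ↔ K.IsMinimalComplex a v b

/-- The arrow `u → w` belongs to a minimal complex of `G`. -/
def IsComplexArrow (G : MixedGraph V) (u w : V) : Prop :=
  ∃ (r : ℕ) (a : V) (v : Fin (r + 1) → V) (b : V), G.IsMinimalComplex a v b ∧
    ((u = a ∧ w = v 0) ∨ (u = b ∧ w = v (Fin.last r)))

/-- Remove the direction of every arrow `a → b` for which `P a b` fails. -/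
def keepArrows (G : MixedGraph V) (P : V → V → Prop) : MixedGraph V where
  E a b := G.E a b ∨ (G.Arrow b a ∧ ¬ P b a)
  irrefl a h := h.elim (G.irrefl a) fun h => G.irrefl a h.1.1

/-- The pattern of `G`: the directions of all arrows outside minimal complexes are removed. -/
def pattern (G : MixedGraph V) : MixedGraph V := G.keepArrows G.IsComplexArrow

/-- There is an undirected path `w₁ = x 0 − ⋯ − x n = w₂` (possibly of length zero) on which `u₁`
is adjacent to no vertex other than `w₁`, and `u₂` to no vertex other than `w₂`. -/
def AvoidingPath (G : MixedGraph V) (u₁ u₂ w₁ w₂ : V) : Prop :=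
  ∃ (n : ℕ) (x : Fin (n + 1) → V), Function.Injective x ∧ x 0 = w₁ ∧ x (Fin.last n) = w₂ ∧
    (∀ i j : Fin (n + 1), (i : ℕ) + 1 = j → G.Line (x i) (x j)) ∧
    (∀ i, i ≠ 0 → ¬ G.Adj u₁ (x i)) ∧ ∀ i, i ≠ Fin.last n → ¬ G.Adj u₂ (x i)

/-- The labelling of candidate arrows: two arrows `u₁ → w₁` and `u₂ → w₂`, with `u₁ ≠ u₂` not
adjacent, are both labelled when there is an undirected path from `w₁` to `w₂` as above. The
condition is symmetric in the two arrows, so it is enough to describe the first one. The path may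
have chords that are arrows, so this test does not look for induced subgraphs. -/
def Labelled (G : MixedGraph V) (u₁ w₁ : V) : Prop :=
  G.Arrow u₁ w₁ ∧ ∃ u₂ w₂, G.Arrow u₂ w₂ ∧ u₁ ≠ u₂ ∧ ¬ G.Adj u₁ u₂ ∧ G.AvoidingPath u₁ u₂ w₁ w₂

/-- The result of the labelling procedure: the directions of all unlabelled arrows are removed. -/
def labelProcedure (G : MixedGraph V) : MixedGraph V := G.keepArrows G.Labelled

/-- An undirected graph, as a mixed graph. -/
def ofSimple (H : SimpleGraph V) : MixedGraph V where
  E := H.Adj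
  irrefl a h := H.loopless.irrefl a h

/-- Orient the edge `u − w` as `u → w`. -/
def orient (G : MixedGraph V) (u w : V) : MixedGraph V where
  E a b := G.E a b ∧ ¬ (a = w ∧ b = u)
  irrefl a h := G.irrefl a h.1

end MixedGraph

section Algorithm

/- `CI u v S` is the independence oracle: its answer to the query whether `u` and `v` are
independent given `S`. -/
variable {V : Type*} [Fintype V] [DecidableEq V] (CI : V → V → Finset V → Prop)

/-- State of the skeleton recovery: the current undirected graph and the recorded separators. -/
structure SkeletonState (V : Type*) where
  H : SimpleGraph V
  sep : V → V → Finset V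

/-- The complete graph. No separator has been recorded yet; the entry `∅` is a placeholder. -/
def SkeletonState.init (V : Type*) : SkeletonState V := ⟨⊤, fun _ _ => ∅⟩

/-- One edge removal at level `i`: an ordered pair `(u, v)` of adjacent vertices with
`|ad_H(u) \ v| ≥ i` and a set `S ⊆ ad_H(u) \ v` with `|S| = i` and `u ⫫ v | S` are selected,
`S` is recorded as `S_uv = S_vu`, and the edge `u − v` is removed. -/
inductive SkeletonStep (i : ℕ) (s : SkeletonState V) : SkeletonState V → Prop
  | remove (u v : V) (S : Finset V) (adj : s.H.Adj u v)
      (deg : i ≤ (s.H.neighborSet u \ {v}).ncard)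
      (sub : (S : Set V) ⊆ s.H.neighborSet u \ {v}) (card : S.card = i) (indep : CI u v S) :
      SkeletonStep i s
        ⟨s.H.deleteEdges {s(u, v)},
          fun a b => if (a = u ∧ b = v) ∨ (a = v ∧ b = u) then S else s.sep a b⟩

/-- Level `i` of the skeleton recovery, run from `s` to `t`: edges are removed, in any order, until
no further removal is possible. -/
def SkeletonLevel (i : ℕ) (s t : SkeletonState V) : Prop :=
  Relation.ReflTransGen (SkeletonStep CI i) s t ∧ ∀ t', ¬ SkeletonStep CI i t t'

/-- `SkeletonLevels CI k s`: the state `s` can be reached after the levels `0, …, k - 1`. -/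
inductive SkeletonLevels : ℕ → SkeletonState V → Prop
  | zero : SkeletonLevels 0 (SkeletonState.init V)
  | succ (k : ℕ) (s t : SkeletonState V) (hs : SkeletonLevels k s) (ht : SkeletonLevel CI k s t) :
      SkeletonLevels (k + 1) t

/-- A possible outcome of the whole skeleton recovery, with levels `0, …, |V| - 2`. -/
def SkeletonOutcome (s : SkeletonState V) : Prop := SkeletonLevels CI (Fintype.card V - 1) s

open Classical in
/-- Body of the inner loop: if `u − w` is (still) undirected in `K` and `u`, `v` are dependent
given `S_uv ∪ {w}`, orient it as `u → w`. -/
noncomputable def orientStep (sep : V → V → Finset V) (u v : V) (K : MixedGraph V) (w : V) :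
    MixedGraph V :=
  if K.Line u w ∧ ¬ CI u v (insert w (sep u v)) then K.orient u w else K

/-- The double loop of the complex recovery. The outer loop visits the pairs `(u, v)` in the list
`pairs`; for the pair `q = (u, v)` the inner loop visits the vertices `w` in the list `nbrs q`. -/
noncomputable def recover (s : SkeletonState V) (pairs : List (V × V)) (nbrs : V × V → List V) :
    MixedGraph V :=
  pairs.foldl (fun K q => (nbrs q).foldl (orientStep CI s.sep q.1 q.2) K) (MixedGraph.ofSimple s.H)

/-- `K` is a possible value of the graph `H*` after the complex recovery loops, started from the
outcome `s` of the skeleton recovery. The pairs of distinct non-adjacent vertices (each of them in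
both roles `(u, v)` and `(v, u)`) and the neighbours `w` of `u` are visited in any order. -/
def RecoveryOutcome (s : SkeletonState V) (K : MixedGraph V) : Prop :=
  ∃ (pairs : List (V × V)) (nbrs : V × V → List V),
    (∀ u v, (u, v) ∈ pairs ↔ u ≠ v ∧ ¬ s.H.Adj u v) ∧
    (∀ q w, w ∈ nbrs q ↔ s.H.Adj q.1 w) ∧
    K = recover CI s pairs nbrs

/-- `K` is a possible value of `H*` just before the final step of the algorithm, over all orders in
which vertex pairs, conditioning sets and edges may be selected. -/
def PreOutput (K : MixedGraph V) : Prop :=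
  ∃ s : SkeletonState V, SkeletonOutcome CI s ∧ RecoveryOutcome CI s K

end Algorithm

section Distribution

open MeasureTheory

variable {V : Type*} [Fintype V] {𝓧 : V → Type*} [∀ v, MeasurableSpace (𝓧 v)]
  [∀ v, StandardBorelSpace (𝓧 v)]

/-- Under the joint distribution `p`, the variables in `A` are conditionally independent of the
variables in `B` given the variables in `S`. -/
def Indep (p : Measure (∀ v, 𝓧 v)) [IsFiniteMeasure p] (A B S : Finset V) : Prop :=
  ProbabilityTheory.CondIndepFun
    (MeasurableSpace.comap (S.restrict : (∀ v, 𝓧 v) → ∀ v : S, 𝓧 v) inferInstance)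
    (Finset.measurable_restrict S).comap_le
    (A.restrict : (∀ v, 𝓧 v) → ∀ v : A, 𝓧 v) (B.restrict : (∀ v, 𝓧 v) → ∀ v : B, 𝓧 v) p

/-- `p` is faithful to `G`: its conditional independencies are exactly the c-separations of `G`. -/
def Faithful (p : Measure (∀ v, 𝓧 v)) [IsFiniteMeasure p] (G : MixedGraph V) : Prop :=
  ∀ A B S : Finset V, Disjoint A B → Disjoint A S → Disjoint B S →
    (Indep p A B S ↔ G.CSep A B S)

/-- The perfect independence oracle of `p` for single vertices. -/
def oracle (p : Measure (∀ v, 𝓧 v)) [IsFiniteMeasure p] (u v : V) (S : Finset V) : Prop :=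
  Indep p {u} {v} S

end Distribution

end LWF

/-! Faithfulness turns every query of the algorithm into a c-separation statement, so the argument
is purely graph-theoretic.

Skeleton: adjacent vertices are never separated, and of two non-adjacent vertices one is separated
from the other by its boundary (`IsChainGraph.cSep_bd_or`). That boundary has at most |V| - 2
elements, all adjacent to the vertex and never lost from its neighbourhood, so some level tests it
unless the edge has gone before. Hence `H` ends as the skeleton of `G`, with a separator recorded
for each non-adjacent pair.

Orientation: adding to a separator a vertex of the ancestral set in question keeps it a separator
(`CSep.insert_of_mem_An`). If `w - u` or `w → u` in `G`, then `w` is such a vertex, so `u → w` is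
never created and every arrow of `H*` is an arrow of `G`. Conversely, two non-adjacent parents of
one chain component become dependent when a child in it is added (`not_cSep_insert_of_coparents`),
so all arrows of minimal complexes are found. `H*` therefore lies between `G` and its pattern, and
undirecting arrows outside complexes neither creates nor destroys a complex
(`IsPartialPattern.isComplexPath_iff`).

Labelling is subtler: it does not test for induced subgraphs, and `H*` may leave arrows of `G`
undirected. Two closure properties of the arrows found, collected in `IsRecovered`, force a shortest
labelling path to span a minimal complex of `G` (`IsRecovered.isComplexArrow_of_labelled`). -/

namespace LWF

/-! ### Shortest walks -/

/-- There is an `R`-walk of length `n` from `a` to `b`. -/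
def WalkLength {V : Type*} (R : V → V → Prop) (n : ℕ) (a b : V) : Prop :=
  ∃ f : ℕ → V, f 0 = a ∧ f n = b ∧ ∀ i < n, R (f i) (f (i + 1))

namespace WalkLength

variable {V : Type*} {R : V → V → Prop}

theorem append {m n : ℕ} {a b c : V} (h₁ : WalkLength R m a b) (h₂ : WalkLength R n b c) :
    WalkLength R (m + n) a c := by
  obtain ⟨f, f0, fm, hf⟩ := h₁
  obtain ⟨g, g0, gn, hg⟩ := h₂
  refine ⟨fun k => if k ≤ m then f k else g (k - m), by simpa using f0, ?_, ?_⟩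
  · by_cases hn : n = 0
    · subst hn
      simp [fm, ← gn, g0]
    · have : ¬ m + n ≤ m := by omega
      simp [hn, gn]
  · intro i hi
    rcases lt_trichotomy i m with h | h | h
    · simpa [h.le, Nat.succ_le_of_lt h] using hf i h
    · subst h
      have := hg 0 (by omega)
      simpa [fm, ← g0] using this
    · have h1 : ¬ i ≤ m := by omega
      have h2 : ¬ i + 1 ≤ m := by omega
      have := hg (i - m) (by omega)
      simpa [h1, h2, show i + 1 - m = i - m + 1 by omega] using this

theorem segment {n : ℕ} {f : ℕ → V} (hf : ∀ i < n, R (f i) (f (i + 1))) {i j : ℕ} (hij : i ≤ j)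
    (hj : j ≤ n) : WalkLength R (j - i) (f i) (f j) :=
  ⟨fun k => f (i + k), rfl, by simp [hij], fun k hk => hf (i + k) (by omega)⟩

theorem of_reflTransGen {a b : V} (h : Relation.ReflTransGen R a b) : ∃ n, WalkLength R n a b := by
  induction h with
  | refl => exact ⟨0, fun _ => a, rfl, rfl, by simp⟩
  | @tail c d _ hcd ih =>
    obtain ⟨n, hn⟩ := ih
    refine ⟨n + 1, hn.append ⟨fun k => if k = 0 then c else d, by simp, by simp, ?_⟩⟩
    intro i hi
    obtain rfl : i = 0 := by omega
    simpa using hcd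

end WalkLength

/-- Reachable vertices are joined by a walk without repetitions and shortcuts. -/
theorem exists_shortest_walk {V : Type*} {R : V → V → Prop} {a b : V}
    (h : Relation.ReflTransGen R a b) :
    ∃ (n : ℕ) (f : ℕ → V), f 0 = a ∧ f n = b ∧ (∀ i < n, R (f i) (f (i + 1))) ∧
      (∀ i j, i < j → j ≤ n → f i ≠ f j) ∧ ∀ i j, i + 1 < j → j ≤ n → ¬ R (f i) (f j) := by
  classical
  have hex := WalkLength.of_reflTransGen h
  obtain ⟨f, f0, fn, hf⟩ := Nat.find_spec hex
  have hmin : ∀ m, WalkLength R m a b → Nat.find hex ≤ m := fun m hm => Nat.find_min' hex hm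
  generalize Nat.find hex = n at *
  subst f0 fn
  -- Cutting out the part between two equal vertices, or replacing it by a shortcut of length one,
  -- would shorten the walk.
  refine ⟨n, f, rfl, rfl, hf, ?_, ?_⟩
  · intro i j hij hj he
    have h1 := WalkLength.segment hf (Nat.zero_le i) (by omega)
    have h2 := WalkLength.segment hf hj le_rfl
    rw [he] at h1
    have := hmin _ (h1.append h2)
    omega
  · intro i j hij hj hR
    have h1 := WalkLength.segment hf (Nat.zero_le i) (by omega)
    have h2 := WalkLength.segment hf hj le_rfl
    have h3 : WalkLength R 1 (f i) (f j) :=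
      ⟨fun k => if k = 0 then f i else f j, by simp, by simp, by simpa using hR⟩
    have := hmin _ ((h1.append h3).append h2)
    omega

/-! ### Adjacency and reachability in chain graphs -/

namespace MixedGraph

variable {V : Type*} {G K : MixedGraph V}

theorem adj_iff {a b : V} : G.Adj a b ↔ G.E a b ∨ G.E b a := by
  unfold Adj Arrow Line
  tauto

theorem Adj.symm {a b : V} (h : G.Adj a b) : G.Adj b a := by
  rw [adj_iff] at *
  exact h.symm

theorem Adj.ne {a b : V} (h : G.Adj a b) : a ≠ b := by
  rintro rfl
  rw [adj_iff] at h
  exact h.elim (G.irrefl _) (G.irrefl _)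

theorem Line.symm {a b : V} (h : G.Line a b) : G.Line b a := ⟨h.2, h.1⟩

theorem Arrow.adj {a b : V} (h : G.Arrow a b) : G.Adj a b := Or.inl h

theorem Line.adj {a b : V} (h : G.Line a b) : G.Adj a b := Or.inr (Or.inr h)

theorem SameComponent.symm {a b : V} (h : G.SameComponent a b) : G.SameComponent b a := by
  have : Std.Symm G.Line := ⟨fun _ _ h => Line.symm h⟩
  exact Relation.ReflTransGen.stdSymm.symm _ _ h

theorem SameComponent.reach {a b : V} (h : G.SameComponent a b) : Relation.ReflTransGen G.E a b :=
  Relation.ReflTransGen.mono (fun _ _ h => h.1) _ _ h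

/-- In a chain graph no arrow lies on a closed semi-directed walk. -/
theorem IsChainGraph.not_reach (hG : G.IsChainGraph) {a b : V} (hab : G.Arrow a b) :
    ¬ Relation.ReflTransGen G.E b a := by
  intro h
  obtain ⟨n, f, f0, fn, hf, hne, -⟩ := exists_shortest_walk h
  have hn0 : n ≠ 0 := by
    rintro rfl
    exact hab.adj.ne (fn.symm.trans f0)
  have hn1 : n ≠ 1 := by
    rintro rfl
    have := hf 0 (by omega)
    rw [f0, zero_add, fn] at this
    exact hab.2 this
  -- The cycle is `f 0, …, f n`, closed by the arrow from `f n = a` to `f 0 = b`; the default value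
  -- `f 0` beyond `n` supplies its end point.
  refine hG ⟨n + 1, fun k => if k ≤ n then f k else f 0, by omega, ?_, by simp, ?_, n, by omega, ?_⟩
  · intro i hi j hj hij
    have hi' : i ≤ n := Nat.lt_succ_iff.1 hi
    have hj' : j ≤ n := Nat.lt_succ_iff.1 hj
    simp only [hi', hj', if_true] at hij
    rcases lt_trichotomy i j with h | h | h
    · exact absurd hij (hne i j h hj')
    · exact h
    · exact absurd hij.symm (hne j i h hi')
  · intro i hi
    rcases Nat.lt_succ_iff_lt_or_eq.1 hi with h | rfl
    · have h1 : i + 1 ≤ n := h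
      have := hf i h
      simp only [h.le, h1, if_true]
      unfold Line Arrow
      tauto
    · right
      simpa [f0, fn] using hab
  · simpa [f0, fn] using hab

/-! ### Ancestral sets -/

/-- `E` holds along arrows and, both ways, along lines, so being ancestral means being closed under
`E`-predecessors. -/
theorem mem_An_iff {A : Set V} {v : V} :
    v ∈ G.An A ↔ ∃ a ∈ A, Relation.ReflTransGen G.E v a := by
  constructor
  · intro h
    refine h {v | ∃ a ∈ A, Relation.ReflTransGen G.E v a} ⟨fun a ha => ⟨a, ha, .refl⟩, ?_⟩
    rintro b ⟨a, ha, hba⟩ c ⟨-, d, rfl, hcd⟩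
    exact ⟨a, ha, .head (hcd.elim (·.1) (·.1)) hba⟩
  · rintro ⟨a, ha, hva⟩ B ⟨hAB, hB⟩
    induction hva using Relation.ReflTransGen.head_induction_on with
    | refl => exact hAB ha
    | @head c d hcd _ ih =>
      by_cases h : c = d
      · exact h ▸ ih
      · refine hB d ih ⟨h, d, rfl, ?_⟩
        unfold Arrow Line
        tauto

theorem subset_An {A : Set V} : A ⊆ G.An A := fun a ha => mem_An_iff.2 ⟨a, ha, .refl⟩

theorem An_of_reach {A : Set V} {a b : V} (h : Relation.ReflTransGen G.E a b) (hb : b ∈ G.An A) :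
    a ∈ G.An A := by
  obtain ⟨c, hc, hbc⟩ := mem_An_iff.1 hb
  exact mem_An_iff.2 ⟨c, hc, h.trans hbc⟩

theorem An_subset {A B : Set V} (h : A ⊆ G.An B) : G.An A ⊆ G.An B := by
  intro v hv
  obtain ⟨a, ha, hva⟩ := mem_An_iff.1 hv
  exact An_of_reach hva (h ha)

/-! ### Moral graphs of induced subgraphs -/

theorem induce_arrow {A : Set V} {a b : V} :
    (G.induce A).Arrow a b ↔ a ∈ A ∧ b ∈ A ∧ G.Arrow a b := by
  simp only [Arrow, induce]
  tauto

theorem induce_line {A : Set V} {a b : V} :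
    (G.induce A).Line a b ↔ a ∈ A ∧ b ∈ A ∧ G.Line a b := by
  simp only [Line, induce]
  tauto

theorem induce_sameComponent_mono {A B : Set V} (h : A ⊆ B) {a b : V}
    (hab : (G.induce A).SameComponent a b) : (G.induce B).SameComponent a b := by
  refine Relation.ReflTransGen.mono (fun c d hcd => ?_) _ _ hab
  rw [induce_line] at *
  exact ⟨h hcd.1, h hcd.2.1, hcd.2.2⟩

/-- Ancestral sets are unions of chain components, so restricting to one does not cut a component.
-/
theorem induce_sameComponent {A : Set V} {a b : V} (hab : G.SameComponent a b)
    (ha : a ∈ G.An A) : (G.induce (G.An A)).SameComponent a b := by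
  induction hab with
  | refl => exact .refl
  | @tail c d hac hcd ih =>
    have hc : c ∈ G.An A := An_of_reach (SameComponent.reach (SameComponent.symm hac)) ha
    exact .tail ih (induce_line.2 ⟨hc, An_of_reach (.single hcd.2) hc, hcd⟩)

theorem moral_induce_mono {A B : Set V} (h : A ⊆ B) :
    (G.induce A).moral ≤ (G.induce B).moral := by
  have key : ∀ a b, ((G.induce A).Arrow a b ∨ (G.induce A).Line a b ∨ (G.induce A).Arrow b a ∨
      ∃ c d, (G.induce A).SameComponent c d ∧ (G.induce A).Arrow a c ∧ (G.induce A).Arrow b d) →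
      ((G.induce B).Arrow a b ∨ (G.induce B).Line a b ∨ (G.induce B).Arrow b a ∨
      ∃ c d, (G.induce B).SameComponent c d ∧ (G.induce B).Arrow a c ∧ (G.induce B).Arrow b d) := by
    have ha : ∀ a b, (G.induce A).Arrow a b → (G.induce B).Arrow a b := by
      intro a b hab
      rw [induce_arrow] at *
      exact ⟨h hab.1, h hab.2.1, hab.2.2⟩
    have hl : ∀ a b, (G.induce A).Line a b → (G.induce B).Line a b := by
      intro a b hab
      rw [induce_line] at *
      exact ⟨h hab.1, h hab.2.1, hab.2.2⟩
    rintro a b (hab | hab | hab | ⟨c, d, hcd, hac, hbd⟩)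
    · exact Or.inl (ha _ _ hab)
    · exact Or.inr (Or.inl (hl _ _ hab))
    · exact Or.inr (Or.inr (Or.inl (ha _ _ hab)))
    · exact Or.inr (Or.inr (Or.inr
        ⟨c, d, induce_sameComponent_mono h hcd, ha _ _ hac, ha _ _ hbd⟩))
  intro a b hab
  simp only [moral, SimpleGraph.fromRel_adj] at *
  exact ⟨hab.1, hab.2.imp (key a b) (key b a)⟩

theorem mem_of_moral_induce_adj {A : Set V} {a b : V} (h : (G.induce A).moral.Adj a b) :
    b ∈ A := by
  simp only [moral, SimpleGraph.fromRel_adj, induce_arrow, induce_line] at h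
  obtain ⟨-, h | h⟩ := h
  · rcases h with h | h | h | ⟨_, _, h⟩ <;> tauto
  · rcases h with h | h | h | ⟨_, _, h⟩ <;> tauto

theorem mem_of_mem_support {A : Set V} {a b x : V} (w : (G.induce A).moral.Walk a b) (ha : a ∈ A)
    (hx : x ∈ w.support) : x ∈ A := by
  induction w with
  | nil => simpa using (by simpa using hx : x = _) ▸ ha
  | cons h w ih =>
    rw [SimpleGraph.Walk.support_cons, List.mem_cons] at hx
    rcases hx with rfl | hx
    · exact ha
    · exact ih (mem_of_moral_induce_adj h) hx

/-! ### Separation -/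

theorem CSep.symm {A B S : Set V} (h : G.CSep A B S) : G.CSep B A S := by
  unfold CSep at *
  rw [Set.union_comm B A]
  intro b hb a ha w
  obtain ⟨s, hs, hS⟩ := h a ha b hb w.reverse
  exact ⟨s, by simpa using hs, hS⟩

theorem not_cSep_of_moral_adj {a b : V} {S : Set V}
    (h : (G.induce (G.An ({a} ∪ {b} ∪ S))).moral.Adj a b) (ha : a ∉ S) (hb : b ∉ S) :
    ¬ G.CSep {a} {b} S := by
  intro hs
  obtain ⟨s, hsw, hS⟩ := hs a rfl b rfl (.cons h .nil)
  simp only [SimpleGraph.Walk.support_cons, SimpleGraph.Walk.support_nil, List.mem_cons,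
    List.not_mem_nil, or_false] at hsw
  rcases hsw with rfl | rfl
  · exact ha hS
  · exact hb hS

/-- Adjacent vertices are not separated by any set. -/
theorem Adj.not_cSep {a b : V} {S : Set V} (h : G.Adj a b) (ha : a ∉ S) (hb : b ∉ S) :
    ¬ G.CSep {a} {b} S := by
  refine not_cSep_of_moral_adj ?_ ha hb
  have h1 : a ∈ G.An ({a} ∪ {b} ∪ S) := subset_An (by simp)
  have h2 : b ∈ G.An ({a} ∪ {b} ∪ S) := subset_An (by simp)
  simp only [moral, SimpleGraph.fromRel_adj, induce_arrow, induce_line]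
  refine ⟨h.ne, Or.inl ?_⟩
  unfold Adj at h
  tauto

/-- A vertex is separated by its boundary from every vertex that is not a strict descendant. -/
theorem IsChainGraph.cSep_bd (hG : G.IsChainGraph) {u v : V} (huv : u ≠ v)
    (hv : ∀ c, G.Arrow u c → ¬ Relation.ReflTransGen G.E c v) : G.CSep {u} {v} (G.bd {u}) := by
  -- With no child of `u` in the ancestral set, moralization adds no edge at `u`; every walk leaving
  -- `u` enters the boundary at once.
  have hchild : ∀ c ∈ G.An ({u} ∪ {v} ∪ G.bd {u}), ¬ G.Arrow u c := by
    intro c hc huc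
    obtain ⟨a, ha, hca⟩ := mem_An_iff.1 hc
    rcases ha with (rfl | rfl) | ⟨-, b, rfl, hab⟩
    · exact hG.not_reach huc hca
    · exact hv c huc hca
    · exact hG.not_reach huc (hca.tail (hab.elim (·.1) (·.1)))
  rintro a rfl b rfl w
  cases w with
  | nil => exact absurd rfl huv
  | @cons _ x _ h w =>
    refine ⟨x, List.mem_cons_of_mem _ w.start_mem_support, ?_⟩
    simp only [moral, SimpleGraph.fromRel_adj, induce_arrow, induce_line] at h
    obtain ⟨hne, h⟩ := h
    have hbd : G.Arrow x a ∨ G.Line x a := by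
      rcases h with (h | h | h | ⟨c, d, -, h, -⟩) | (h | h | h | ⟨c, d, -, -, h⟩)
      · exact absurd h.2.2 (hchild _ h.2.1)
      · exact Or.inr h.2.2.symm
      · exact Or.inl h.2.2
      · exact absurd h.2.2 (hchild _ h.2.1)
      · exact Or.inl h.2.2
      · exact Or.inr h.2.2
      · exact absurd h.2.2 (hchild _ h.2.1)
      · exact absurd h.2.2 (hchild _ h.2.1)
    exact ⟨fun h => hne h.symm, a, rfl, hbd⟩

/-- Of two non-adjacent vertices, one is separated from the other by its boundary. -/
theorem IsChainGraph.cSep_bd_or (hG : G.IsChainGraph) {u v : V} (huv : u ≠ v) :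
    G.CSep {u} {v} (G.bd {u}) ∨ G.CSep {v} {u} (G.bd {v}) := by
  by_cases h : ∀ c, G.Arrow u c → ¬ Relation.ReflTransGen G.E c v
  · exact Or.inl (hG.cSep_bd huv h)
  · push Not at h
    obtain ⟨c, huc, hcv⟩ := h
    refine Or.inr (hG.cSep_bd huv.symm fun d hvd hdu => ?_)
    -- `v` descends strictly from `u`; if `u` also descended strictly from `v`, the arrow `v → d`
    -- would lie on a closed semi-directed walk.
    exact hG.not_reach hvd ((hdu.tail huc.1).trans hcv)

/-- Parents of a common chain component are dependent given a set that meets the component. -/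
theorem not_cSep_insert_of_coparents {u v z d : V} {S : Set V} (huz : G.Arrow u z)
    (hvd : G.Arrow v d) (hzd : G.SameComponent z d) (huv : u ≠ v) (hadj : ¬ G.Adj u v)
    (hu : u ∉ S) (hv : v ∉ S) : ¬ G.CSep {u} {v} (insert z S) := by
  have hz : z ∈ G.An ({u} ∪ {v} ∪ insert z S) := subset_An (by simp)
  -- Conditioning on `z` brings its whole component into the ancestral set, so moralization joins
  -- `u` and `v`.
  have hd : d ∈ G.An ({u} ∪ {v} ∪ insert z S) := An_of_reach hzd.symm.reach hz
  refine not_cSep_of_moral_adj ?_ ?_ ?_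
  · simp only [moral, SimpleGraph.fromRel_adj, induce_arrow]
    exact ⟨huv, Or.inl (Or.inr (Or.inr (Or.inr ⟨z, d, induce_sameComponent hzd hz,
      ⟨subset_An (by simp), hz, huz⟩, ⟨subset_An (by simp), hd, hvd⟩⟩)))⟩
  · simp [huz.adj.ne, hu]
  · have : v ≠ z := by
      rintro rfl
      exact hadj huz.adj
    simp [this, hv]

/-- Enlarging a separator within the ancestral set preserves separation. -/
theorem CSep.insert_of_mem_An {A B S : Set V} {x : V} (h : G.CSep A B S)
    (hx : x ∈ G.An (A ∪ B ∪ S)) :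
    G.CSep A B (insert x S) := by
  -- The ancestral set, and with it the moral graph, is unchanged; only the blocking set grows.
  have he : G.An (A ∪ B ∪ insert x S) = G.An (A ∪ B ∪ S) := by
    apply Set.Subset.antisymm
    · refine An_subset ?_
      rintro y ((hy | hy) | (rfl | hy))
      · exact subset_An (by simp [hy])
      · exact subset_An (by simp [hy])
      · exact hx
      · exact subset_An (by simp [hy])
    · refine An_subset fun y hy => subset_An ?_
      simp only [Set.mem_union, Set.mem_insert_iff] at *
      tauto
  unfold CSep at *
  rw [he]
  intro a ha b hb w
  obtain ⟨s, hs, hS⟩ := h a ha b hb w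
  exact ⟨s, hs, Or.inr hS⟩

/-- If `w` opens a connection between `u` and `v`, then so does every child of `u` that is a
strict descendant of `w`. -/
theorem IsChainGraph.not_cSep_insert_descendant (hG : G.IsChainGraph) {u v w z : V} {S : Set V}
    (hS : G.CSep {u} {v} S) (hw : ¬ G.CSep {u} {v} (insert w S)) (huz : G.Arrow u z)
    (hwz : Relation.ReflTransGen G.E w z) (hzw : ¬ Relation.ReflTransGen G.E z w) :
    ¬ G.CSep {u} {v} (insert z S) := by
  have hwA : w ∉ G.An ({u} ∪ {v} ∪ S) := fun h => hw (hS.insert_of_mem_An h)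
  intro hz
  apply hw
  rintro a rfl b rfl p
  have hsub : G.An ({a} ∪ {b} ∪ insert w S) ⊆ G.An ({a} ∪ {b} ∪ insert z S) := by
    refine An_subset ?_
    rintro y (hy | rfl | hy)
    · exact subset_An (Or.inl hy)
    · exact An_of_reach hwz (subset_An (by simp))
    · exact subset_An (by simp [hy])
  obtain ⟨s, hs, hsS⟩ := hz a rfl b rfl (p.mapLe (moral_induce_mono hsub))
  have hs' : s ∈ p.support := by
    rwa [SimpleGraph.Walk.support_mapLe_eq_support] at hs
  rcases hsS with rfl | hsS
  · exfalso
    -- A walk through `z` puts `z` above `u`, `v`, `w` or `S`. Above `u` it contradicts `u → z`,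
    -- above `w` it contradicts strictness, and above `v` or `S` it would carry `w` into the smaller
    -- ancestral set.
    have hsA := mem_of_mem_support p (subset_An (by simp)) hs'
    obtain ⟨y, hy, hsy⟩ := mem_An_iff.1 hsA
    rcases hy with (rfl | rfl) | rfl | hy
    · exact hG.not_reach huz hsy
    · exact hwA (mem_An_iff.2 ⟨y, by simp, hwz.trans hsy⟩)
    · exact hzw hsy
    · exact hwA (mem_An_iff.2 ⟨y, by simp [hy], hwz.trans hsy⟩)
  · exact ⟨s, hs', Or.inr hsS⟩

/-! ### Minimal complexes as induced paths -/

/-- The vertices `y 0, …, y N` form an induced path that is a minimal complex. -/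
structure IsComplexPath (G : MixedGraph V) (N : ℕ) (y : ℕ → V) : Prop where
  two_le : 2 ≤ N
  ne : ∀ i j, i < j → j ≤ N → y i ≠ y j
  left : G.Arrow (y 0) (y 1)
  right : G.Arrow (y N) (y (N - 1))
  line : ∀ k, 0 < k → k + 1 < N → G.Line (y k) (y (k + 1))
  chordless : ∀ i j, i < j → j ≤ N → G.Adj (y i) (y j) → j = i + 1

theorem IsComplexPath.isMinimalComplex {r : ℕ} {y : ℕ → V} (h : G.IsComplexPath (r + 2) y) :
    G.IsMinimalComplex (y 0) (fun i : Fin (r + 1) => y (i + 1)) (y (r + 2)) where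
  ne := h.ne _ _ (by omega) le_rfl
  left_ne i := h.ne _ _ (by omega) (by omega)
  right_ne i := (h.ne _ _ (by omega) le_rfl).symm
  inj i j hij := by
    rcases lt_trichotomy (i : ℕ) j with hlt | he | hlt
    · exact absurd hij (h.ne _ _ (by omega) (by omega))
    · exact Fin.ext he
    · exact absurd hij.symm (h.ne _ _ (by omega) (by omega))
  left := by simpa using h.left
  right := by simpa using h.right
  lines i j hij := by
    have := h.line (i + 1) (by omega) (by omega)
    simpa only [hij] using this
  not_adj ha := by
    have := h.chordless _ _ (by omega) le_rfl ha
    omega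
  left_only i hi := by
    have := h.chordless _ _ (by omega) (by omega) hi
    exact Fin.ext (by simpa using this)
  right_only i hi := by
    have := h.chordless _ _ (by omega) le_rfl hi.symm
    exact Fin.ext (by simp; omega)
  chordless i j hij := by
    rcases lt_trichotomy (i : ℕ) j with hlt | he | hlt
    · have := h.chordless _ _ (by omega) (by omega) hij
      omega
    · exact absurd (congrArg (fun k : ℕ => y (k + 1)) he) hij.ne
    · have := h.chordless _ _ (by omega) (by omega) hij.symm
      omega

/-- The sequence `a, v 0, …, v r, b, b, …`. -/
def pathSeq {r : ℕ} (a : V) (v : Fin (r + 1) → V) (b : V) (k : ℕ) : V :=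
  if k = 0 then a else if h : k - 1 < r + 1 then v ⟨k - 1, h⟩ else b

theorem pathSeq_zero {r : ℕ} (a : V) (v : Fin (r + 1) → V) (b : V) : pathSeq a v b 0 = a := rfl

theorem pathSeq_fin {r : ℕ} (a : V) (v : Fin (r + 1) → V) (b : V) (i : Fin (r + 1)) :
    pathSeq a v b (i + 1) = v i := by
  simp only [pathSeq, Nat.add_eq_zero_iff, one_ne_zero, and_false, if_false, Nat.add_sub_cancel,
    i.isLt, dite_true]

theorem pathSeq_succ {r : ℕ} (a : V) (v : Fin (r + 1) → V) (b : V) {k : ℕ} (hk : k < r + 1) :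
    pathSeq a v b (k + 1) = v ⟨k, hk⟩ := pathSeq_fin a v b ⟨k, hk⟩

theorem pathSeq_last {r : ℕ} (a : V) (v : Fin (r + 1) → V) (b : V) :
    pathSeq a v b (r + 2) = b := by
  simp [pathSeq]

theorem IsMinimalComplex.isComplexPath {r : ℕ} {a b : V} {v : Fin (r + 1) → V}
    (h : G.IsMinimalComplex a v b) : G.IsComplexPath (r + 2) (pathSeq a v b) where
  two_le := by omega
  ne i j hij hj := by
    obtain ⟨j, rfl⟩ : ∃ k, j = k + 1 := ⟨j - 1, by omega⟩
    rcases Nat.eq_zero_or_pos i with rfl | hi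
    · rcases (by omega : j = r + 1 ∨ j < r + 1) with rfl | hj'
      · simpa only [pathSeq_zero, pathSeq_last] using h.ne
      · simpa only [pathSeq_zero, pathSeq_succ _ _ _ hj'] using h.left_ne _
    · obtain ⟨i, rfl⟩ : ∃ k, i = k + 1 := ⟨i - 1, by omega⟩
      have hi' : i < r + 1 := by omega
      rcases (by omega : j = r + 1 ∨ j < r + 1) with rfl | hj'
      · simpa only [pathSeq_succ _ _ _ hi', pathSeq_last] using (h.right_ne _).symm
      · simp only [pathSeq_succ _ _ _ hi', pathSeq_succ _ _ _ hj']
        intro he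
        have := Fin.mk.inj_iff.1 (h.inj he)
        omega
  left := by
    have := h.left
    rwa [← pathSeq_fin a v b 0] at this
  right := by
    have := h.right
    rw [← pathSeq_fin a v b (Fin.last r)] at this
    rwa [pathSeq_last]
  line k hk hkr := by
    obtain ⟨k, rfl⟩ : ∃ m, k = m + 1 := ⟨k - 1, by omega⟩
    rw [pathSeq_succ _ _ _ (by omega), pathSeq_succ _ _ _ (by omega)]
    exact h.lines _ _ rfl
  chordless i j hij hj hadj := by
    obtain ⟨j, rfl⟩ : ∃ k, j = k + 1 := ⟨j - 1, by omega⟩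
    rcases Nat.eq_zero_or_pos i with rfl | hi
    · rcases (by omega : j = r + 1 ∨ j < r + 1) with rfl | hj'
      · rw [pathSeq_zero, pathSeq_last] at hadj
        exact absurd hadj h.not_adj
      · rw [pathSeq_zero, pathSeq_succ _ _ _ hj'] at hadj
        have := Fin.ext_iff.1 (h.left_only _ hadj)
        simpa using this
    · obtain ⟨i, rfl⟩ : ∃ k, i = k + 1 := ⟨i - 1, by omega⟩
      have hi' : i < r + 1 := by omega
      rcases (by omega : j = r + 1 ∨ j < r + 1) with rfl | hj'
      · rw [pathSeq_succ _ _ _ hi', pathSeq_last] at hadj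
        have := Fin.ext_iff.1 (h.right_only _ hadj.symm)
        simp at this
        omega
      · rw [pathSeq_succ _ _ _ hi', pathSeq_succ _ _ _ hj'] at hadj
        have := h.chordless _ _ hadj
        simp at this
        omega

/-- With both ends and the middle in one sequence indexed by ℕ, a section of a path is obtained by
shifting the index. -/
theorem isMinimalComplex_iff {r : ℕ} {a b : V} {v : Fin (r + 1) → V} :
    G.IsMinimalComplex a v b ↔ G.IsComplexPath (r + 2) (pathSeq a v b) := by
  refine ⟨fun h => h.isComplexPath, fun h => ?_⟩
  have := h.isMinimalComplex
  simpa only [pathSeq_fin, pathSeq_zero, pathSeq_last] using this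

theorem IsComplexPath.isComplexArrow_left {N : ℕ} {y : ℕ → V} (h : G.IsComplexPath N y) :
    G.IsComplexArrow (y 0) (y 1) := by
  obtain ⟨r, rfl⟩ : ∃ r, N = r + 2 := ⟨N - 2, by have := h.two_le; omega⟩
  exact ⟨r, _, _, _, h.isMinimalComplex, Or.inl ⟨rfl, by simp⟩⟩

theorem IsComplexPath.isComplexArrow_right {N : ℕ} {y : ℕ → V} (h : G.IsComplexPath N y) :
    G.IsComplexArrow (y N) (y (N - 1)) := by
  obtain ⟨r, rfl⟩ : ∃ r, N = r + 2 := ⟨N - 2, by have := h.two_le; omega⟩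
  exact ⟨r, _, _, _, h.isMinimalComplex, Or.inr ⟨rfl, by simp⟩⟩

theorem IsComplexArrow.arrow {u w : V} (h : G.IsComplexArrow u w) : G.Arrow u w := by
  obtain ⟨r, a, v, b, hc, ⟨rfl, rfl⟩ | ⟨rfl, rfl⟩⟩ := h
  · exact hc.left
  · exact hc.right

/-- A path whose two end edges point inwards contains a section between two arrows pointing at
it, all of whose edges are undirected. -/
theorem exists_collider_section {N : ℕ} {y : ℕ → V} (hN : 0 < N)
    (hadj : ∀ k < N, G.Adj (y k) (y (k + 1))) (hl : G.Arrow (y 0) (y 1))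
    (hr : G.Arrow (y N) (y (N - 1))) :
    ∃ i j, i < j ∧ j < N ∧ G.Arrow (y i) (y (i + 1)) ∧ G.Arrow (y (j + 1)) (y j) ∧
      ∀ k, i < k → k < j → G.Line (y k) (y (k + 1)) := by
  classical
  -- The section ends at the first backward arrow and starts at the last forward arrow before it, so
  -- no arrow remains in between.
  have hex : ∃ j, G.Arrow (y (j + 1)) (y j) := ⟨N - 1, by rwa [Nat.sub_add_cancel hN]⟩
  have hj := Nat.find_spec hex
  have hjN : Nat.find hex ≤ N - 1 := Nat.find_min' hex (by rwa [Nat.sub_add_cancel hN])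
  have hmin : ∀ k < Nat.find hex, ¬ G.Arrow (y (k + 1)) (y k) := fun k hk => Nat.find_min hex hk
  generalize Nat.find hex = j at hj hjN hmin
  have hi : G.Arrow (y (Nat.findGreatest (fun i => G.Arrow (y i) (y (i + 1))) j))
      (y (Nat.findGreatest (fun i => G.Arrow (y i) (y (i + 1))) j + 1)) :=
    Nat.findGreatest_spec (P := fun i => G.Arrow (y i) (y (i + 1))) (Nat.zero_le j) hl
  have hij : Nat.findGreatest (fun i => G.Arrow (y i) (y (i + 1))) j ≤ j := Nat.findGreatest_le j
  have hmax : ∀ k, Nat.findGreatest (fun i => G.Arrow (y i) (y (i + 1))) j < k → k ≤ j →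
      ¬ G.Arrow (y k) (y (k + 1)) := fun k h1 h2 => Nat.findGreatest_is_greatest h1 h2
  generalize Nat.findGreatest (fun i => G.Arrow (y i) (y (i + 1))) j = i at hi hij hmax
  refine ⟨i, j, lt_of_le_of_ne hij ?_, by omega, hi, hj, ?_⟩
  · rintro rfl
    exact hi.2 hj.1
  · intro k h1 h2
    rcases hadj k (by omega) with h | h | h
    · exact absurd h (hmax k h1 h2.le)
    · exact absurd h (hmin k h2)
    · exact h

/-! ### Graphs between a graph and its pattern -/

/-- `K` arises from `G` by removing the directions of some arrows outside minimal complexes. -/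
structure IsPartialPattern (K G : MixedGraph V) : Prop where
  adj : ∀ a b, K.Adj a b ↔ G.Adj a b
  arrow : ∀ a b, K.Arrow a b → G.Arrow a b
  complexArrow : ∀ a b, G.IsComplexArrow a b → K.Arrow a b

namespace IsPartialPattern

theorem line (h : K.IsPartialPattern G) {a b : V} (hab : G.Line a b) : K.Line a b := by
  rcases (h.adj a b).2 hab.adj with h' | h' | h'
  · exact absurd hab.2 (h.arrow _ _ h').2
  · exact absurd hab.1 (h.arrow _ _ h').2
  · exact h'

/-- A complex path of `K` has inward end arrows in `G`, hence contains a collider section of `G`.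
Being induced, the section is a complex of `G`, so `K` keeps its end arrows; since `K` has only
lines inside the path, the section is the whole path. -/
theorem isComplexPath_iff (h : K.IsPartialPattern G) {N : ℕ} {y : ℕ → V} :
    K.IsComplexPath N y ↔ G.IsComplexPath N y := by
  constructor
  · intro hy
    have h2 := hy.two_le
    have hadj : ∀ k < N, G.Adj (y k) (y (k + 1)) := by
      intro k hk
      rw [← h.adj]
      rcases Nat.eq_zero_or_pos k with rfl | hk0
      · exact hy.left.adj
      · rcases (by omega : k + 1 < N ∨ k = N - 1) with hk1 | rfl
        · exact (hy.line k hk0 hk1).adj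
        · have := hy.right.adj.symm
          rwa [← Nat.sub_add_cancel (by omega : 1 ≤ N)] at this
    obtain ⟨i, j, hij, hjN, hi, hj, hline⟩ := exists_collider_section (by omega) hadj
      (h.arrow _ _ hy.left) (h.arrow _ _ hy.right)
    have hsec : G.IsComplexPath (j + 1 - i) (fun k => y (i + k)) :=
      { two_le := by omega
        ne := fun k l hkl hl => hy.ne _ _ (by omega) (by omega)
        left := hi
        right := by
          rw [show i + (j + 1 - i) = j + 1 by omega, show i + (j + 1 - i - 1) = j by omega]
          exact hj
        line := fun k hk hkl => hline (i + k) (by omega) (by omega)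
        chordless := fun k l hkl hl ha => by
          have := hy.chordless _ _ (by omega) (by omega) ((h.adj _ _).2 ha)
          omega }
    have hil := h.complexArrow _ _ hsec.isComplexArrow_left
    have hjr := h.complexArrow _ _ hsec.isComplexArrow_right
    simp only [show i + (j + 1 - i) = j + 1 by omega, show i + (j + 1 - i - 1) = j by omega] at hjr
    have hi0 : i = 0 := by
      by_contra hne
      exact hil.2 (hy.line i (by omega) (by omega)).2
    have hjN' : j + 1 = N := by
      by_contra hne
      exact hjr.2 (hy.line j (by omega) (by omega)).1
    refine ⟨h2, hy.ne, h.arrow _ _ hy.left, h.arrow _ _ hy.right, ?_, ?_⟩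
    · exact fun k hk hkN => hline k (by omega) (by omega)
    · exact fun i j hij hj ha => hy.chordless i j hij hj ((h.adj _ _).2 ha)
  · intro hy
    exact ⟨hy.two_le, hy.ne, h.complexArrow _ _ hy.isComplexArrow_left,
      h.complexArrow _ _ hy.isComplexArrow_right, fun k h1 h2 => h.line (hy.line k h1 h2),
      fun i j hij hj ha => hy.chordless i j hij hj ((h.adj _ _).1 ha)⟩

theorem sameMinimalComplexes (h : K.IsPartialPattern G) : K.SameMinimalComplexes G := by
  intro r a v b
  rw [isMinimalComplex_iff, isMinimalComplex_iff, h.isComplexPath_iff]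

theorem isComplexArrow_iff (h : K.IsPartialPattern G) {u w : V} :
    K.IsComplexArrow u w ↔ G.IsComplexArrow u w := by
  unfold IsComplexArrow
  simp only [h.sameMinimalComplexes _ _ _ _]

end IsPartialPattern

theorem pattern_E_iff {a b : V} : G.pattern.E a b ↔ G.Adj a b ∧ ¬ G.IsComplexArrow b a := by
  have hba : G.IsComplexArrow b a → G.Arrow b a := IsComplexArrow.arrow
  simp only [pattern, keepArrows, adj_iff, Arrow] at *
  tauto

theorem pattern_adj {a b : V} : G.pattern.Adj a b ↔ G.Adj a b := by
  have h1 : G.IsComplexArrow b a → G.Arrow b a := IsComplexArrow.arrow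
  have h2 : G.IsComplexArrow a b → G.Arrow a b := IsComplexArrow.arrow
  have h3 : G.Adj b a ↔ G.Adj a b := ⟨Adj.symm, Adj.symm⟩
  rw [adj_iff, pattern_E_iff, pattern_E_iff]
  unfold Arrow at *
  by_cases h4 : G.IsComplexArrow a b <;> by_cases h5 : G.IsComplexArrow b a <;> simp_all

theorem pattern_arrow {a b : V} : G.pattern.Arrow a b ↔ G.IsComplexArrow a b := by
  have h1 : G.IsComplexArrow b a → G.Arrow b a := IsComplexArrow.arrow
  have h2 : G.IsComplexArrow a b → G.Arrow a b := IsComplexArrow.arrow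
  have h3 : G.Adj b a ↔ G.Adj a b := ⟨Adj.symm, Adj.symm⟩
  have h4 : G.Arrow a b → G.Adj a b := Arrow.adj
  rw [Arrow, pattern_E_iff, pattern_E_iff]
  unfold Arrow at *
  tauto

theorem isPartialPattern_pattern : G.pattern.IsPartialPattern G :=
  ⟨fun _ _ => pattern_adj, fun _ _ h => (pattern_arrow.1 h).arrow, fun _ _ h => pattern_arrow.2 h⟩

theorem IsPartialPattern.pattern_eq (h : K.IsPartialPattern G) : K.pattern = G.pattern := by
  ext a b
  rw [pattern_E_iff, pattern_E_iff, h.adj, h.isComplexArrow_iff]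

/-! ### The labelling procedure -/

theorem IsComplexArrow.labelled {u w : V} (h : G.IsComplexArrow u w) : G.Labelled u w := by
  refine ⟨h.arrow, ?_⟩
  obtain ⟨r, a, v, b, hc, ⟨rfl, rfl⟩ | ⟨rfl, rfl⟩⟩ := h
  · exact ⟨b, v (Fin.last r), hc.right, hc.ne, hc.not_adj, r, v, hc.inj, rfl, rfl, hc.lines,
      fun i hi ha => hi (hc.left_only i ha), fun i hi ha => hi (hc.right_only i ha)⟩
  -- Labelling is stated for the first of two arrows, so for the right-hand arrow the path is
  -- reversed.
  · refine ⟨a, v 0, hc.left, hc.ne.symm, fun ha => hc.not_adj ha.symm, r, v ∘ Fin.rev,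
      hc.inj.comp Fin.rev_injective, by simp, by simp, ?_, ?_, ?_⟩
    · intro i j hij
      refine (hc.lines (Fin.rev j) (Fin.rev i) ?_).symm
      simp only [Fin.val_rev]
      omega
    · intro i hi ha
      apply hi
      rw [← Fin.rev_rev i, hc.right_only _ ha, Fin.rev_last]
    · intro i hi ha
      apply hi
      rw [← Fin.rev_rev i, hc.left_only _ ha, Fin.rev_zero]

/-- The extra properties of the arrows found by the complex recovery: an arrow of the chain graph
is found if its head lies in a chain component with another parent that is not adjacent to its
tail, or if its head is a strict descendant of the head of an arrow found from the same tail. -/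
structure IsRecovered (K G : MixedGraph V) : Prop extends K.IsPartialPattern G where
  of_coparent : ∀ u v z d, G.Arrow u z → G.Arrow v d → G.SameComponent z d → u ≠ v →
    ¬ G.Adj u v → ¬ K.Line u z
  of_descendant : ∀ u w z, K.Arrow u w → G.Arrow u z → Relation.ReflTransGen G.E w z →
    ¬ Relation.ReflTransGen G.E z w → ¬ K.Line u z

/-- A shortest labelling path, extended by `u` and `u'`, contains a collider section of `G`. If the
section were proper, one of its end arrows would be a line of `K` that the recovery must have
oriented; so it is the whole path, and the chain graph property excludes the remaining chords. -/
theorem IsRecovered.isComplexArrow_of_labelled (h : K.IsRecovered G) (hG : G.IsChainGraph)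
    {u w : V} (hl : K.Labelled u w) : G.IsComplexArrow u w := by
  obtain ⟨huw, u', w', huw', hne, hnadj, m, x, xinj, x0, xm, xline, xu, xu'⟩ := hl
  -- The avoidance conditions are phrased by vertex instead of index, so that they survive the
  -- passage to a shorter walk.
  let P : V → Prop := fun z => (z ≠ w → ¬ K.Adj u z) ∧ (z ≠ w' → ¬ K.Adj u' z)
  have hP : ∀ i, P (x i) := by
    intro i
    refine ⟨fun hi => xu i ?_, fun hi => xu' i ?_⟩
    · rintro rfl
      exact hi x0
    · rintro rfl
      exact hi xm
  have hreach : ∀ i : Fin (m + 1),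
      Relation.ReflTransGen (fun a b => K.Line a b ∧ P a ∧ P b) w (x i) := by
    intro i
    induction i using Fin.induction with
    | zero => rw [x0]
    | succ i ih => exact ih.tail ⟨xline _ _ (by simp), hP _, hP _⟩
  have hreach' := hreach (Fin.last m)
  rw [xm] at hreach'
  have hPw : P w := x0 ▸ hP 0
  obtain ⟨n, f, f0, fn, hf, finj, fshort⟩ := exists_shortest_walk hreach'
  have hPf : ∀ i ≤ n, P (f i) := by
    intro i hi
    rcases Nat.eq_zero_or_pos i with rfl | hi0
    · rwa [f0]
    · have := (hf (i - 1) (by omega)).2.2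
      rwa [Nat.sub_add_cancel hi0] at this
  have hu : ∀ i, 0 < i → i ≤ n → ¬ K.Adj u (f i) := fun i h0 hi =>
    (hPf i hi).1 fun he => finj 0 i h0 hi (f0.trans he.symm)
  have hu' : ∀ i, i < n → ¬ K.Adj u' (f i) := fun i hi =>
    (hPf i hi.le).2 fun he => finj i n hi le_rfl (he.trans fn.symm)
  -- If `u` were on the walk after `w`, its predecessor would be a neighbour: `w` is joined to `u`
  -- by an arrow, not a line, and any later vertex is forbidden by `P`.
  have huf : ∀ i, i ≤ n → u ≠ f i := by
    rintro i hi rfl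
    rcases Nat.eq_zero_or_pos i with rfl | h0
    · exact huw.adj.ne f0
    · have h1 := (hf (i - 1) (by omega)).1.adj.symm
      rw [Nat.sub_add_cancel h0] at h1
      rcases Nat.eq_zero_or_pos (i - 1) with h2 | h2
      · have := (hf (i - 1) (by omega)).1
        rw [Nat.sub_add_cancel h0, h2, f0] at this
        exact huw.2 this.1
      · exact hu _ h2 (by omega) h1
  have huf' : ∀ i, i ≤ n → u' ≠ f i := by
    rintro i hi rfl
    rcases hi.lt_or_eq with hi | rfl
    · have h1 := (hf i hi).1
      rcases (show i + 1 < n ∨ i + 1 = n by omega) with h2 | h2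
      · exact hu' _ h2 h1.adj
      · rw [h2, fn] at h1
        exact huw'.2 h1.2
    · exact huw'.adj.ne fn
  let y : ℕ → V := fun k => if k = 0 then u else if k ≤ n + 1 then f (k - 1) else u'
  have y0 : y 0 = u := rfl
  have yin : ∀ k, 0 < k → k ≤ n + 1 → y k = f (k - 1) := by
    intro k h0 hk
    simp only [y, h0.ne', hk, if_true, if_false]
  have yN : y (n + 2) = u' := by simp [y]
  have hKG : ∀ a b, K.Adj a b ↔ G.Adj a b := h.adj
  have hline : ∀ k, 0 < k → k < n + 1 → K.Line (y k) (y (k + 1)) := by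
    intro k h0 hk
    rw [yin k h0 (by omega), yin (k + 1) (by omega) (by omega)]
    have := (hf (k - 1) (by omega)).1
    rwa [Nat.sub_add_cancel h0] at this
  have hleft : G.Arrow (y 0) (y 1) := by
    rw [y0, yin 1 (by omega) (by omega), f0]
    exact h.arrow _ _ huw
  have hright : G.Arrow (y (n + 2)) (y (n + 1)) := by
    rw [yN, yin (n + 1) (by omega) (by omega), Nat.add_sub_cancel, fn]
    exact h.arrow _ _ huw'
  have hadj : ∀ k < n + 2, G.Adj (y k) (y (k + 1)) := by
    intro k hk
    rcases Nat.eq_zero_or_pos k with rfl | h0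
    · exact hleft.adj
    · rcases (show k < n + 1 ∨ k = n + 1 by omega) with h1 | rfl
      · exact (hKG _ _).1 (hline k h0 h1).adj
      · exact hright.adj.symm
  have yne : ∀ i j, i < j → j ≤ n + 2 → y i ≠ y j := by
    intro i j hij hj
    rcases Nat.eq_zero_or_pos i with rfl | hi
    · rcases (show j = n + 2 ∨ j ≤ n + 1 by omega) with rfl | hj
      · rwa [y0, yN]
      · rw [y0, yin j hij hj]
        exact huf _ (by omega)
    · rcases (show j = n + 2 ∨ j ≤ n + 1 by omega) with rfl | hj
      · rw [yin i hi (by omega), yN]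
        exact (huf' _ (by omega)).symm
      · rw [yin i hi (by omega), yin j (by omega) hj]
        exact finj _ _ (by omega) (by omega)
  -- Minimality excludes only lines of `K` as inner chords; arrows are still possible. At `u` and
  -- `u'` no chord exists at all.
  have ychord : ∀ i j, i + 1 < j → j ≤ n + 2 → ¬ K.Line (y i) (y j) ∧
      (i = 0 ∨ j = n + 2 → ¬ K.Adj (y i) (y j)) := by
    intro i j hij hj
    rcases Nat.eq_zero_or_pos i with rfl | hi
    · rcases (show j = n + 2 ∨ j ≤ n + 1 by omega) with rfl | hj
      · rw [y0, yN]
        exact ⟨fun h => hnadj h.adj, fun _ => hnadj⟩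
      · rw [y0, yin j (by omega) hj]
        have := hu (j - 1) (by omega) (by omega)
        exact ⟨fun h => this h.adj, fun _ => this⟩
    · rcases (show j = n + 2 ∨ j ≤ n + 1 by omega) with rfl | hj
      · rw [yin i hi (by omega), yN]
        have := hu' (i - 1) (by omega)
        exact ⟨fun h => this h.adj.symm, fun _ h => this h.symm⟩
      · rw [yin i hi (by omega), yin j (by omega) hj]
        refine ⟨fun hl => fshort (i - 1) (j - 1) (by omega) (by omega)
          ⟨hl, hPf _ (by omega), hPf _ (by omega)⟩, fun h => ?_⟩
        omega
  obtain ⟨i, j, hij, hjN, hi, hj, hsec⟩ := exists_collider_section (by omega) hadj hleft hright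
  have hcomp : ∀ k, i < k → k ≤ j → G.SameComponent (y (i + 1)) (y k) := by
    intro k hk
    induction k, hk using Nat.le_induction with
    | base => exact fun _ => .refl
    | succ k hk ih => exact fun hkj => .tail (ih (by omega)) (hsec k hk (by omega))
  have hc := hcomp j hij le_rfl
  have hij' := yne i (j + 1) (by omega) (by omega)
  -- If the outer vertices of a proper section are non-adjacent, `of_coparent` orients an inner
  -- edge. If they are adjacent, both are inner vertices joined by an arrow of `K`, say `y i → y (j
  -- + 1)`; then `y (i + 1)` is a strict descendant of its head and `of_descendant` applies.
  have hends : i = 0 ∧ j = n + 1 := by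
    by_contra hcon
    by_cases hK : K.Adj (y i) (y (j + 1))
    · have hin : ¬ (i = 0 ∨ j + 1 = n + 2) := fun h0 =>
        (ychord i (j + 1) (by omega) (by omega)).2 h0 hK
      push Not at hin
      rcases hK with hK | hK | hK
      · refine h.of_descendant _ _ _ hK hi (.head hj.1 hc.symm.reach) (fun hr => ?_)
          (hline i (by omega) (by omega))
        exact hG.not_reach hj (hc.symm.reach.trans hr)
      · refine h.of_descendant _ _ _ hK hj (.head hi.1 hc.reach) (fun hr => ?_)
          (hline j (by omega) (by omega)).symm
        exact hG.not_reach hi (hc.reach.trans hr)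
      · exact (ychord i (j + 1) (by omega) (by omega)).1 hK
    · have hGadj : ¬ G.Adj (y i) (y (j + 1)) := fun h' => hK ((hKG _ _).2 h')
      rcases (show 0 < i ∨ j < n + 1 by omega) with h0 | h0
      · exact h.of_coparent _ _ _ _ hi hj hc hij' hGadj (hline i h0 (by omega))
      · exact h.of_coparent _ _ _ _ hj hi hc.symm hij'.symm (fun h' => hGadj h'.symm)
          (hline j (by omega) h0).symm
  obtain ⟨rfl, rfl⟩ := hends
  have hpath : G.IsComplexPath (n + 2) y :=
    { two_le := by omega
      ne := yne
      left := hleft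
      right := hright
      line := fun k h0 hk => hsec k h0 (by omega)
      chordless := by
        intro i j hij hj ha
        by_contra hcon
        have hch := ychord i j (by omega) hj
        by_cases h0 : i = 0 ∨ j = n + 2
        · exact hch.2 h0 ((hKG _ _).2 ha)
        -- Both vertices lie in one component, so the chord is not an arrow of `G`; as a line it
        -- would persist in `K`.
        · have hcij : G.SameComponent (y i) (y j) :=
            (hcomp i (by omega) (by omega)).symm.trans (hcomp j (by omega) (by omega))
          rcases ha with ha | ha | ha
          · exact hG.not_reach ha hcij.symm.reach
          · exact hG.not_reach ha hcij.reach
          · exact hch.1 (h.line ha) }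
  have := hpath.isComplexArrow_left
  rwa [y0, yin 1 (by omega) (by omega), f0] at this

theorem IsRecovered.labelProcedure_eq (h : K.IsRecovered G) (hG : G.IsChainGraph) :
    K.labelProcedure = K.pattern := by
  have hiff : ∀ a b, K.Labelled a b ↔ K.IsComplexArrow a b := fun a b =>
    ⟨fun hl => h.isComplexArrow_iff.2 (h.isComplexArrow_of_labelled hG hl), fun hc => hc.labelled⟩
  ext a b
  simp only [labelProcedure, pattern, keepArrows, hiff]

end MixedGraph

/-! ### Separators, sound states and the oracle -/

variable {V : Type*} {G : MixedGraph V}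

/-- `S` is a set, containing neither `u` nor `v`, that separates them. -/
def IsSeparator (G : MixedGraph V) (u v : V) (S : Finset V) : Prop :=
  u ∉ S ∧ v ∉ S ∧ G.CSep {u} {v} S

theorem IsSeparator.symm {u v : V} {S : Finset V} (h : IsSeparator G u v S) :
    IsSeparator G v u S := ⟨h.2.1, h.1, h.2.2.symm⟩

/-- The state contains all adjacencies of `G`, and the removed edges have separators. -/
def IsSound (G : MixedGraph V) (s : SkeletonState V) : Prop :=
  (∀ u v, G.Adj u v → s.H.Adj u v) ∧
    ∀ u v, u ≠ v → ¬ s.H.Adj u v → IsSeparator G u v (s.sep u v)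

theorem isSound_init : IsSound G (SkeletonState.init V) :=
  ⟨fun _ _ h => h.ne, fun _ _ h h' => absurd h h'⟩

variable [DecidableEq V]

/-- The oracle `CI` answers queries about single vertices according to separation in `G`. -/
def IsOracle (CI : V → V → Finset V → Prop) (G : MixedGraph V) : Prop :=
  ∀ u v S, u ≠ v → u ∉ S → v ∉ S → (CI u v S ↔ G.CSep {u} {v} S)

variable {CI : V → V → Finset V → Prop}

/-! ### Skeleton recovery -/

/-- A removed pair has a separator avoiding both ends, which no edge of `G` admits. -/
theorem SkeletonStep.isSound (hCI : IsOracle CI G) {i : ℕ} {s t : SkeletonState V}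
    (h : SkeletonStep CI i s t) (hs : IsSound G s) : IsSound G t := by
  obtain ⟨u, v, S, adj, deg, sub, card, indep⟩ := h
  have hu : u ∉ S := fun h => (sub h).1.ne rfl
  have hv : v ∉ S := fun h => (sub h).2 rfl
  have hsep : IsSeparator G u v S := ⟨hu, hv, (hCI u v S adj.ne hu hv).1 indep⟩
  refine ⟨fun a b hab => ?_, fun a b hne hab => ?_⟩
  · simp only [SimpleGraph.deleteEdges_adj, Set.mem_singleton_iff, Sym2.eq_iff]
    refine ⟨hs.1 a b hab, ?_⟩
    rintro (⟨rfl, rfl⟩ | ⟨rfl, rfl⟩)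
    · exact hab.not_cSep hsep.1 hsep.2.1 hsep.2.2
    · exact hab.not_cSep hsep.2.1 hsep.1 hsep.2.2.symm
  · simp only [SimpleGraph.deleteEdges_adj, Set.mem_singleton_iff, Sym2.eq_iff] at hab
    by_cases hc : (a = u ∧ b = v) ∨ (a = v ∧ b = u)
    · simp only [hc, if_true]
      rcases hc with ⟨rfl, rfl⟩ | ⟨rfl, rfl⟩
      · exact hsep
      · exact hsep.symm
    · simp only [hc, if_false]
      exact hs.2 a b hne fun h => hab ⟨h, hc⟩

theorem SkeletonStep.lt {i : ℕ} {s t : SkeletonState V} (h : SkeletonStep CI i s t) :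
    t.H < s.H := by
  obtain ⟨u, v, S, adj, -, -, -, -⟩ := h
  refine lt_of_le_of_ne (SimpleGraph.deleteEdges_le _) fun he => ?_
  have : (s.H.deleteEdges {s(u, v)}).Adj u v := by
    simp only at he
    rwa [he]
  simp at this

theorem SkeletonLevel.isSound (hCI : IsOracle CI G) {i : ℕ} {s t : SkeletonState V}
    (h : SkeletonLevel CI i s t) (hs : IsSound G s) : IsSound G t := by
  obtain ⟨h, -⟩ := h
  induction h with
  | refl => exact hs
  | tail _ hstep ih => exact hstep.isSound hCI ih

theorem SkeletonLevel.le {i : ℕ} {s t : SkeletonState V} (h : SkeletonLevel CI i s t) :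
    t.H ≤ s.H := by
  obtain ⟨h, -⟩ := h
  induction h with
  | refl => exact le_rfl
  | tail _ hstep ih => exact hstep.lt.le.trans ih

theorem SkeletonLevels.isSound (hCI : IsOracle CI G) {k : ℕ} {s : SkeletonState V}
    (h : SkeletonLevels CI k s) : IsSound G s := by
  induction h with
  | zero => exact isSound_init
  | succ k s t _ ht ih => exact ht.isSound hCI ih

/-! ### Complex recovery -/

/-- The oracle finds `u` and `v` dependent once `w` is added to their recorded separator. -/
def Opens (CI : V → V → Finset V → Prop) (s : SkeletonState V) (u w : V) : Prop :=
  ∃ v, u ≠ v ∧ ¬ s.H.Adj u v ∧ ¬ CI u v (insert w (s.sep u v))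

theorem orientStep_E (sep : V → V → Finset V) (u v : V) (K : MixedGraph V) (w a b : V) :
    (orientStep CI sep u v K w).E a b ↔ K.E a b ∧
      ¬ (K.Line u w ∧ ¬ CI u v (insert w (sep u v)) ∧ a = w ∧ b = u) := by
  unfold orientStep
  split_ifs with h
  · simp only [MixedGraph.orient]
    tauto
  · tauto

theorem recover_eq_foldl (s : SkeletonState V) (pairs : List (V × V)) (nbrs : V × V → List V) :
    recover CI s pairs nbrs =
      (pairs.flatMap fun q => (nbrs q).map fun w => (q, w)).foldl
        (fun K t => orientStep CI s.sep t.1.1 t.1.2 K t.2) (MixedGraph.ofSimple s.H) := by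
  rw [List.foldl_flatMap]
  simp only [List.foldl_map]
  rfl

theorem foldl_orientStep_le (sep : V → V → Finset V) (l : List ((V × V) × V)) (K : MixedGraph V)
    {a b : V} (h : (l.foldl (fun K t => orientStep CI sep t.1.1 t.1.2 K t.2) K).E a b) :
    K.E a b := by
  induction l generalizing K with
  | nil => exact h
  | cons t l ih => exact ((orientStep_E _ _ _ _ _ _ _).1 (ih _ h)).1

theorem foldl_orientStep_not_line (sep : V → V → Finset V) (l : List ((V × V) × V))
    (K : MixedGraph V) {u v w : V} (hl : ((u, v), w) ∈ l) (hw : ¬ CI u v (insert w (sep u v))) :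
    ¬ (l.foldl (fun K t => orientStep CI sep t.1.1 t.1.2 K t.2) K).Line u w := by
  induction l generalizing K with
  | nil => simp at hl
  | cons t l ih =>
    rcases List.mem_cons.1 hl with rfl | hl
    · intro h
      have h1 := (orientStep_E _ _ _ _ _ _ _).1 (foldl_orientStep_le sep l _ h.1)
      have h2 := (orientStep_E _ _ _ _ _ _ _).1 (foldl_orientStep_le sep l _ h.2)
      exact h2.2 ⟨⟨h1.1, h2.1⟩, hw, rfl, rfl⟩
    · exact ih _ hl

/-- Loop invariant: a step acts only on an undirected edge, so each edge loses at most one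
direction, and only with a witness. -/
theorem foldl_orientStep_opens (s : SkeletonState V) (l : List ((V × V) × V)) (K : MixedGraph V)
    (hl : ∀ t ∈ l, t.1.1 ≠ t.1.2 ∧ ¬ s.H.Adj t.1.1 t.1.2)
    (hK : ∀ a b, s.H.Adj a b → ¬ K.E a b → K.E b a ∧ Opens CI s b a) {a b : V} (hab : s.H.Adj a b)
    (h : ¬ (l.foldl (fun K t => orientStep CI s.sep t.1.1 t.1.2 K t.2) K).E a b) :
    (l.foldl (fun K t => orientStep CI s.sep t.1.1 t.1.2 K t.2) K).E b a ∧ Opens CI s b a := by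
  induction l generalizing K with
  | nil => exact hK a b hab h
  | cons t l ih =>
    refine ih _ (fun t ht => hl t (List.mem_cons_of_mem _ ht)) (fun a b hab h => ?_) h
    rw [orientStep_E] at h ⊢
    by_cases hE : K.E a b
    · simp only [hE, true_and, not_not] at h
      obtain ⟨hline, hopen, rfl, rfl⟩ := h
      have ht := hl t List.mem_cons_self
      exact ⟨⟨hline.1, fun h' => hab.ne h'.2.2.2⟩, t.1.2, ht.1, ht.2, hopen⟩
    · obtain ⟨h1, h2⟩ := hK a b hab hE
      exact ⟨⟨h1, fun h' => hE (by rw [h'.2.2.1, h'.2.2.2]; exact h'.1.1)⟩, h2⟩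

/-- These facts hold for every visiting order; the order could matter only for an edge that opens in
both directions. -/
theorem RecoveryOutcome.spec {s : SkeletonState V} {K : MixedGraph V}
    (h : RecoveryOutcome CI s K) :
    (∀ a b, K.Adj a b ↔ s.H.Adj a b) ∧ (∀ a b, K.Arrow a b → Opens CI s a b) ∧
      ∀ a b, s.H.Adj a b → Opens CI s a b → ¬ K.Line a b := by
  obtain ⟨pairs, nbrs, hpairs, hnbrs, rfl⟩ := h
  rw [recover_eq_foldl]
  have hmem : ∀ u v w, ((u, v), w) ∈ (pairs.flatMap fun q => (nbrs q).map fun w => (q, w)) ↔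
      (u ≠ v ∧ ¬ s.H.Adj u v) ∧ s.H.Adj u w := by
    intro u v w
    simp only [List.mem_flatMap, List.mem_map, Prod.mk.injEq, ← hpairs]
    constructor
    · rintro ⟨q, hq, x, hx, rfl, rfl⟩
      exact ⟨hq, (hnbrs _ _).1 hx⟩
    · rintro ⟨hq, hx⟩
      exact ⟨(u, v), hq, w, (hnbrs _ _).2 hx, rfl, rfl⟩
  generalize (pairs.flatMap fun q => (nbrs q).map fun w => (q, w)) = l at hmem
  have hle := fun a b => foldl_orientStep_le (CI := CI) s.sep l (.ofSimple s.H) (a := a) (b := b)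
  have hop := fun a b => foldl_orientStep_opens (CI := CI) s l (.ofSimple s.H) (a := a) (b := b)
    (fun t ht => ((hmem t.1.1 t.1.2 t.2).1 ht).1) (fun _ _ hab h => absurd hab h)
  have hline : ∀ a b, s.H.Adj a b → Opens CI s a b →
      ¬ (l.foldl (fun K t => orientStep CI s.sep t.1.1 t.1.2 K t.2) (.ofSimple s.H)).Line a b := by
    rintro a b hab ⟨v, hne, hn, hv⟩
    exact foldl_orientStep_not_line s.sep l _ ((hmem a v b).2 ⟨⟨hne, hn⟩, hab⟩) hv
  generalize l.foldl (fun K t => orientStep CI s.sep t.1.1 t.1.2 K t.2) (.ofSimple s.H) = K at *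
  refine ⟨fun a b => ?_, fun a b hab => ?_, hline⟩
  · rw [MixedGraph.adj_iff]
    refine ⟨fun h => h.elim (hle a b) fun h => (hle b a h).symm, fun h => ?_⟩
    by_cases hE : K.E a b
    · exact Or.inl hE
    · exact Or.inr (hop a b h hE).1
  · exact (hop b a (hle a b hab.1).symm hab.2).2

/-! ### Outcomes of the algorithm -/

variable [Fintype V]

/-- After the level `|S|` all pairs separated by a set `S` of adjacent vertices are removed. -/
theorem SkeletonLevels.not_adj (hCI : IsOracle CI G) {k : ℕ} {s : SkeletonState V}
    (h : SkeletonLevels CI k s) {u v : V} {S : Finset V} (hS : IsSeparator G u v S)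
    (hadj : ∀ x ∈ S, G.Adj u x) (hk : S.card < k) : ¬ s.H.Adj u v := by
  induction h with
  | zero => omega
  | succ k s t hs ht ih =>
    rcases (Nat.lt_succ_iff_lt_or_eq.1 hk) with hk | rfl
    · exact fun h' => ih hk (ht.le h')
    · intro huv
      -- Soundness keeps the neighbours of `u` in `G` adjacent to it, so a surviving edge `u - v`
      -- would permit another removal at this level.
      have hsub : (S : Set V) ⊆ t.H.neighborSet u \ {v} := by
        intro x hx
        refine ⟨(ht.isSound hCI (hs.isSound hCI)).1 u x (hadj x hx), ?_⟩
        rintro rfl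
        exact hS.2.1 hx
      refine ht.2 _ (.remove u v S huv ?_ hsub rfl ((hCI u v S huv.ne hS.1 hS.2.1).2 hS.2.2))
      rw [← Set.ncard_coe_finset]
      exact Set.ncard_le_ncard hsub (Set.toFinite _)

/-- The skeleton recovery finds the skeleton. -/
theorem SkeletonOutcome.adj_iff (hCI : IsOracle CI G) (hG : G.IsChainGraph) {s : SkeletonState V}
    (h : SkeletonOutcome CI s) (u v : V) : s.H.Adj u v ↔ G.Adj u v := by
  classical
  refine ⟨fun huv => ?_, (SkeletonLevels.isSound hCI h).1 u v⟩
  by_contra hn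
  have key : ∀ a b, s.H.Adj a b → ¬ G.Adj a b → ¬ G.CSep {a} {b} (G.bd {a}) := by
    intro a b hab hn hs
    have hmem : ∀ x, x ∈ (G.bd {a}).toFinset → x ≠ a ∧ G.Adj a x := by
      intro x hx
      obtain ⟨h1, c, rfl, h2⟩ := Set.mem_toFinset.1 hx
      exact ⟨h1, h2.elim (fun h => h.adj.symm) fun h => h.adj.symm⟩
    have hsep : IsSeparator G a b (G.bd {a}).toFinset :=
      ⟨fun h => (hmem a h).1 rfl, fun h => hn (hmem b h).2, by simpa using hs⟩
    refine SkeletonLevels.not_adj hCI h hsep (fun x hx => (hmem x hx).2) ?_ hab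
    -- The boundary misses both `a` and `b`, so its size is at most |V| - 2, the last level run.
    have hcard : (insert a (insert b (G.bd {a}).toFinset)).card = (G.bd {a}).toFinset.card + 2 := by
      rw [Finset.card_insert_of_notMem, Finset.card_insert_of_notMem hsep.2.1]
      simpa [hab.ne] using hsep.1
    have := Finset.card_le_univ (insert a (insert b (G.bd {a}).toFinset))
    omega
  rcases hG.cSep_bd_or huv.ne with hs | hs
  · exact key u v huv hn hs
  · exact key v u huv.symm (fun h => hn h.symm) hs

theorem exists_skeletonLevel (CI : V → V → Finset V → Prop) (i : ℕ) (s : SkeletonState V) :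
    ∃ t, SkeletonLevel CI i s t := by
  obtain ⟨H, hH⟩ : ∃ H, s.H = H := ⟨_, rfl⟩
  -- Each removal makes `H` strictly smaller, which cannot go on forever on a finite vertex set.
  induction H using WellFoundedLT.induction generalizing s with
  | ind H ih =>
    subst hH
    by_cases h : ∃ t, SkeletonStep CI i s t
    · obtain ⟨t, ht⟩ := h
      obtain ⟨r, hr⟩ := ih t.H ht.lt t rfl
      exact ⟨r, .head ht hr.1, hr.2⟩
    · exact ⟨s, .refl, fun t ht => h ⟨t, ht⟩⟩

theorem exists_skeletonLevels (CI : V → V → Finset V → Prop) (k : ℕ) :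
    ∃ s, SkeletonLevels CI k s := by
  induction k with
  | zero => exact ⟨_, .zero⟩
  | succ k ih =>
    obtain ⟨s, hs⟩ := ih
    obtain ⟨t, ht⟩ := exists_skeletonLevel CI k s
    exact ⟨t, .succ k s t hs ht⟩

theorem exists_preOutput (CI : V → V → Finset V → Prop) : ∃ K, PreOutput CI K := by
  classical
  obtain ⟨s, hs⟩ := exists_skeletonLevels CI (Fintype.card V - 1)
  refine ⟨_, s, hs, (Finset.univ.filter fun q : V × V => q.1 ≠ q.2 ∧ ¬ s.H.Adj q.1 q.2).toList,
    fun q => (Finset.univ.filter fun w => s.H.Adj q.1 w).toList, ?_, ?_, rfl⟩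
  · simp
  · simp

theorem PreOutput.isRecovered (hCI : IsOracle CI G) (hG : G.IsChainGraph) {K : MixedGraph V}
    (h : PreOutput CI K) : K.IsRecovered G := by
  obtain ⟨s, hs, hK⟩ := h
  have hH := hs.adj_iff hCI hG
  have hsep : ∀ u v, u ≠ v → ¬ G.Adj u v → IsSeparator G u v (s.sep u v) := fun u v hne hn =>
    (SkeletonLevels.isSound hCI hs).2 u v hne fun h => hn ((hH u v).1 h)
  obtain ⟨hadj, harrow, hline⟩ := hK.spec
  simp only [hH] at hadj hline
  have hopens : ∀ u w, G.Adj u w → (Opens CI s u w ↔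
      ∃ v, u ≠ v ∧ ¬ G.Adj u v ∧ ¬ G.CSep {u} {v} (insert w (s.sep u v : Set V))) := by
    intro u w huw
    unfold Opens
    refine exists_congr fun v => and_congr_right fun hne => ?_
    rw [hH]
    refine and_congr_right fun hn => ?_
    have hS := hsep u v hne hn
    have hvw : v ≠ w := by
      rintro rfl
      exact hn huw
    rw [hCI u v _ hne (by simp [huw.ne, hS.1]) (by simp [hvw, hS.2.1]), Finset.coe_insert]
  -- `u` is an ancestor or neighbour of `w`, hence already in the ancestral set, and adding it
  -- preserves the recorded separation.
  have hnot : ∀ u w, G.E u w → ¬ Opens CI s w u := by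
    intro u w huw ho
    obtain ⟨v, hne, hn, hv⟩ := (hopens w u (MixedGraph.adj_iff.2 (Or.inr huw))).1 ho
    exact hv ((hsep w v hne hn).2.2.insert_of_mem_An
      (MixedGraph.mem_An_iff.2 ⟨w, by simp, .single huw⟩))
  have hcop : ∀ u v z d, G.Arrow u z → G.Arrow v d → G.SameComponent z d → u ≠ v →
      ¬ G.Adj u v → Opens CI s u z := fun u v z d huz hvd hzd hne hn =>
    (hopens u z huz.adj).2 ⟨v, hne, hn, MixedGraph.not_cSep_insert_of_coparents huz hvd hzd hne hn
      (hsep u v hne hn).1 (hsep u v hne hn).2.1⟩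
  have hKG : ∀ a b, K.Arrow a b → G.Arrow a b := by
    intro a b hab
    have hE : ¬ G.E b a := fun h => hnot b a h (harrow a b hab)
    exact ⟨(MixedGraph.adj_iff.1 ((hadj a b).1 hab.adj)).resolve_right hE, hE⟩
  have hGK : ∀ a b, G.Arrow a b → Opens CI s a b → K.Arrow a b := by
    intro a b hab ho
    rcases (hadj a b).2 hab.adj with h | h | h
    · exact h
    · exact absurd (hKG b a h).1 hab.2
    · exact absurd h (hline a b hab.adj ho)
  refine ⟨⟨hadj, hKG, ?_⟩, ?_, ?_⟩
  · rintro u w ⟨r, a, v, b, hc, hor⟩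
    have hcomp : ∀ i, G.SameComponent (v 0) (v i) := by
      intro i
      induction i using Fin.induction with
      | zero => exact .refl
      | succ i ih => exact .tail ih (hc.lines _ _ (by simp))
    rcases hor with ⟨rfl, rfl⟩ | ⟨rfl, rfl⟩
    · exact hGK _ _ hc.left (hcop _ _ _ _ hc.left hc.right (hcomp _) hc.ne hc.not_adj)
    · exact hGK _ _ hc.right (hcop _ _ _ _ hc.right hc.left (hcomp _).symm hc.ne.symm
        fun h => hc.not_adj h.symm)
  · exact fun u v z d huz hvd hzd hne hn => hline u z huz.adj (hcop u v z d huz hvd hzd hne hn)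
  · intro u w z huw huz hwz hzw
    refine hline u z huz.adj ((hopens u z huz.adj).2 ?_)
    obtain ⟨v, hne, hn, hv⟩ := (hopens u w (hKG u w huw).adj).1 (harrow u w huw)
    exact ⟨v, hne, hn, hG.not_cSep_insert_descendant (hsep u v hne hn).2.2 hv huz hwz hzw⟩

end LWF

/-! ### From the distribution to the graph -/

theorem lemma2 {V : Type*} [Fintype V] [DecidableEq V] {𝓧 : V → Type*}
    [∀ v, MeasurableSpace (𝓧 v)] [∀ v, StandardBorelSpace (𝓧 v)]
    (p : MeasureTheory.Measure (∀ v, 𝓧 v)) [MeasureTheory.IsProbabilityMeasure p]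
    (G : LWF.MixedGraph V) (hG : G.IsChainGraph) (hp : LWF.Faithful p G) :
    (∃ Hstar, LWF.PreOutput (LWF.oracle p) Hstar) ∧
    ∀ Hstar, LWF.PreOutput (LWF.oracle p) Hstar →
      Hstar.pattern.SameAdjacencies G ∧
      Hstar.pattern.SameMinimalComplexes G ∧
      Hstar.pattern = G.pattern ∧
      Hstar.labelProcedure = Hstar.pattern := by
  -- Faithfulness at singletons makes the oracle answer c-separation queries.
  have hCI : LWF.IsOracle (LWF.oracle p) G := by
    intro u v S hne hu hv
    have := hp {u} {v} S (by simpa using hne) (by simpa using hu) (by simpa using hv)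
    simpa only [LWF.oracle, Finset.coe_singleton] using this
  refine ⟨LWF.exists_preOutput _, fun Hstar hH => ?_⟩
  have hrec := hH.isRecovered hCI hG
  have hpat := hrec.pattern_eq
  rw [hrec.labelProcedure_eq hG, hpat]
  exact ⟨fun _ _ => LWF.MixedGraph.pattern_adj,
    LWF.MixedGraph.isPartialPattern_pattern.sameMinimalComplexes, rfl, rfl⟩
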